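/- Let $n\ge 0$ be an integer and let $S_3$ denote the set of linear orderings of three alternatives $1,2,3$. A generalized social welfare function (GSWF) on three alternatives with $n$ voters is a function $F$ that assigns to each profile in $(S_3)^n$ a preference between the two alternatives of each of the three pairs. The outcome for a profile is transitive if these three preferences form a linear ordering of the alternatives. $F$ satisfies the Independence of Irrelevant Alternatives (IIA) condition if, for all alternatives $A,B$, the preference of $F$ between $A$ and $B$ depends only on the preferences of the individual voters between $A$ and $B$. All probabilities are with respect to the uniform measure on $(S_3)^n$, and expectations of functions on $\{0,1\}^n$ are with respect to the uniform measure. For an IIA GSWF $F$, let $F_{ab}:\{0,1\}^n\to\{0,1\}$ be the choice function on the pair $(a,b)$: $F_{ab}(x)=1$ if and only if $F$ prefers $a$ over $b$ when the voters that prefer $a$ over $b$ are exactly those $k$ with $x_k=1$. Put $$p_1=\mathbb E[F_{12}],\quad p_2=\mathbb E[F_{23}],\quad p_3=\mathbb E[F_{31}],\qquad D_2'(F)=\min_{1\le i\le 3}\min(p_i,1-p_i),$$ let $P(F)$ be the probability that the outcome of $F$ is not transitive, and let $$D_1(F)=\min_G \Pr[F\ne G],$$ where the minimum is over all GSWFs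 $G$ on three alternatives with $n$ voters that satisfy the IIA condition and whose outcome is always transitive. For $0<p<1$ and $0<q\le 1$ let $$RHC(p,q)=p\cdot p^{\frac{(\sqrt{\alpha}+1/3)^2}{1-(1/3)^2}},\qquad \alpha=\log_p q ,$$ and let $RHC(p,q)=0$ if $p=0$ or $q=0$; in particular $RHC(p,p)=p^3$. If $F$ is a GSWF on three alternatives with $n$ voters that satisfies the IIA condition and $D_2'(F)\le 2^{-500000}$, then $$P(F)\ \ge\ \frac1{10}\cdot\max\Big(RHC\big(D_1(F)/2,\,D_1(F)/2\big),\ RHC\big(D_2'(F),\,1/2\big)\Big).$$ -/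

import Mathlib

namespace Arrow

/-- The unordered pairs of the `k` alternatives, represented as pairs `i < j`. -/
abbrev Pairs (k : ℕ) : Type := {p : Fin k × Fin k // p.1 < p.2}

/-- A linear ordering of the `k` alternatives, given by the position of each alternative:
`a` is preferred over `b` when `σ a < σ b`. -/
abbrev Ranking (k : ℕ) : Type := Equiv.Perm (Fin k)

/-- A profile: one linear ordering of the alternatives for each of the `n` voters. -/
abbrev Profile (k n : ℕ) : Type := Fin n → Ranking k

/-- An outcome: the preference of the society on each pair `i < j`, where
`true` means that `i` is preferred over `j`. -/
abbrev Outcome (k : ℕ) : Type := Pairs k → Bool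

/-- Generalized social welfare functions on `k` alternatives with `n` voters. -/
abbrev GSWF (k n : ℕ) : Type := Profile k n → Outcome k

/-- Whether the voter with ranking `σ` prefers `a` over `b`. -/
def voterPrefers {k : ℕ} (σ : Ranking k) (a b : Fin k) : Bool := decide (σ a < σ b)

/-- Whether the outcome `o` prefers `a` over `b` (in either order of the indices). -/
def societyPrefers {k : ℕ} (o : Outcome k) (a b : Fin k) : Bool :=
  if h : a < b then o ⟨(a, b), h⟩ else if h : b < a then !(o ⟨(b, a), h⟩) else false

/-- The outcome is (represented by) a full linear ordering of the alternatives. -/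
def Outcome.IsTransitive {k : ℕ} (o : Outcome k) : Prop :=
  ∃ σ : Ranking k, ∀ a b : Fin k, societyPrefers o a b = voterPrefers σ a b

/-- Independence of irrelevant alternatives. -/
def IIA {k n : ℕ} (F : GSWF k n) : Prop :=
  ∀ (a b : Fin k) (X Y : Profile k n),
    (∀ v, voterPrefers (X v) a b = voterPrefers (Y v) a b) →
      societyPrefers (F X) a b = societyPrefers (F Y) a b

/-- A ranking that prefers `a` over `b` (where `a ≠ b`) exactly when `t = true`. -/
def pairRanking {k : ℕ} (a b : Fin k) (t : Bool) : Ranking k :=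
  if t = decide (a < b) then 1 else Equiv.swap a b

/-- The Boolean choice function `F_{ab}`: the preference of the society between `a` and `b`
when voter `v` prefers `a` over `b` exactly when `x v = true`. -/
def choiceFn {k n : ℕ} (F : GSWF k n) (a b : Fin k) : (Fin n → Bool) → Bool :=
  fun x => societyPrefers (F fun v => pairRanking a b (x v)) a b

theorem voterPrefers_pairRanking {k : ℕ} {a b : Fin k} (hab : a ≠ b) (t : Bool) :
    voterPrefers (pairRanking a b t) a b = t := by
  unfold voterPrefers pairRanking
  rcases lt_or_gt_of_ne hab with h | h
  · cases t <;> simp [h, h.le]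
  · cases t <;> simp [h, h.not_gt]

/-- For a GSWF with the IIA property, the choice function really computes the preference of the
society between `a` and `b` from the individual preferences between `a` and `b`. -/
theorem IIA.societyPrefers_eq {k n : ℕ} {F : GSWF k n} (hF : IIA F) {a b : Fin k} (hab : a ≠ b)
    (X : Profile k n) :
    societyPrefers (F X) a b = choiceFn F a b fun v => voterPrefers (X v) a b :=
  hF a b _ _ fun _ => (voterPrefers_pairRanking hab _).symm

open Classical in
/-- The probability of an event under the uniform measure on a finite set. -/
noncomputable def uniformProb {α : Type*} [Fintype α] (p : α → Prop) : ℝ :=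
  ((Finset.univ.filter p).card : ℝ) / (Fintype.card α : ℝ)

/-- The expectation of a Boolean function under the uniform measure on the discrete cube. -/
noncomputable def expect {n : ℕ} (f : (Fin n → Bool) → Bool) : ℝ :=
  (∑ x : Fin n → Bool, if f x = true then (1 : ℝ) else 0) / 2 ^ n

/-- `P(F)`: the probability of a non-transitive outcome for a uniform random profile. -/
noncomputable def nonTransProb {k n : ℕ} (F : GSWF k n) : ℝ :=
  uniformProb fun X : Profile k n => ¬ (F X).IsTransitive

/-- The family of GSWFs that satisfy IIA and whose outcome is always transitive. -/
def transitiveFamily (k n : ℕ) : Set (GSWF k n) :=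
  {G | IIA G ∧ ∀ X, (G X).IsTransitive}

/-- `Pr[F ≠ G]` for a uniform random profile. -/
noncomputable def gswfDist {k n : ℕ} (F G : GSWF k n) : ℝ :=
  uniformProb fun X : Profile k n => F X ≠ G X

/-- `D₁(F)`: the minimal distance of `F` from the IIA, always transitive GSWFs. -/
noncomputable def D₁ {k n : ℕ} (F : GSWF k n) : ℝ :=
  sInf (gswfDist F '' transitiveFamily k n)

/-- The infimum in the definition of `D₁` is a minimum. -/
theorem D₁_isLeast {k n : ℕ} (F : GSWF k n) :
    IsLeast (gswfDist F '' transitiveFamily k n) (D₁ F) := by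
  have hne : (transitiveFamily k n).Nonempty := by
    refine ⟨fun _ _ => true, fun _ _ _ _ _ => rfl, fun _ => ⟨1, fun a b => ?_⟩⟩
    rcases lt_trichotomy a b with h | h | h
    · simp [societyPrefers, voterPrefers, h]
    · simp [societyPrefers, voterPrefers, h]
    · simp [societyPrefers, voterPrefers, h, h.not_gt]
  have hfin : (gswfDist F '' transitiveFamily k n).Finite := (Set.toFinite _).image _
  exact ⟨(hne.image _).csInf_mem hfin, fun _ h => csInf_le hfin.bddBelow h⟩

/-- `p̄ = min (p, 1 - p)`. -/
noncomputable def pbar (p : ℝ) : ℝ := min p (1 - p)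

/-- `D₂'(F)`: the least `p̄ᵢ`, where `p₁, p₂, p₃` are the expectations of the choice functions on
the pairs `(1, 2)`, `(2, 3)` and `(3, 1)` of alternatives (numbered `0, 1, 2` below). -/
noncomputable def D₂' {n : ℕ} (F : GSWF 3 n) : ℝ :=
  min (pbar (expect (choiceFn F 0 1)))
    (min (pbar (expect (choiceFn F 1 2))) (pbar (expect (choiceFn F 2 0))))

/-- The lower bound `p ^ (1 + (√α + ε)² / (1 - ε²))`, `q = p ^ α`, at `ε = 1/3`, of the reverse
hypercontractive inequality for the noise correlation of two Boolean functions on the cube with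
expectations `p, q ∈ [0, 1]`. The first two cases are the boundary values of this expression
where no real number `α` with `q = p ^ α` determines it. -/
noncomputable def RHC (p q : ℝ) : ℝ :=
  if p = 0 ∨ q = 0 then 0
  else if p = 1 then q ^ (9 / 8 : ℝ)
  else p * p ^ ((√(Real.logb p q) + 1 / 3) ^ 2 / (1 - (1 / 3 : ℝ) ^ 2))

end Arrow

namespace Arrow

open Real Set

/-! Some cyclic choice takes a value `s` with probability `ε = D₂' F`. Call this event f, and let g
and h be the events that the next two choices take the value `!s`, with probabilities q, r ≥ ε. An
outcome is non-transitive exactly when its three cyclic choices agree, and inclusion-exclusion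
cancels the triple term: P(F) = ε + P(g ∧ h) - P(f ∧ h) - P(f ∧ g) (`IIA.nonTransProb_eq`). Forcing
two choices to opposite constants gives `D₁ F` ≤ ε + q and `D₁ F` ≤ ε + r, so `D₁ F / 2` ≤ min(q, r)
(`IIA.D₁_le`).

A random voter's preferences on adjacent cyclic pairs have correlation -1/3. Reverse
hypercontractivity (`rpow_mul_rpow_le_piMean`) bounds P(g ∧ h), P(f ∧ ¬h) and P(f ∧ ¬g) from below;
hypercontractivity (`piMean_le_rpow_mul_rpow`) bounds the subtracted terms from above. Both are
proved for one voter and tensorized. The case analysis on ε, q, r in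
`max_le_of_correlation_bounds_of_le` shows that the subtracted terms never consume more than a
constant fraction of what is needed. -/

/-! ### Two-point inequalities -/

theorem mul_le_rpow_sub_rpow {c b : ℝ} (hc₀ : 0 < c) (hc₁ : c < 1) (hb₀ : 0 ≤ b) (hb₁ : b < 1) :
    2 * c * b ≤ (1 + b) ^ c - (1 - b) ^ c := by
  have hmono : MonotoneOn (fun t : ℝ => (1 + t) ^ c - (1 - t) ^ c - 2 * c * t) (Ico 0 1) := by
    have hderiv : ∀ t ∈ Ico (0 : ℝ) 1,
        HasDerivAt (fun t : ℝ => (1 + t) ^ c - (1 - t) ^ c - 2 * c * t)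
          (c * (1 + t) ^ (c - 1) + c * (1 - t) ^ (c - 1) - 2 * c) t := by
      intro t ht
      have h₁ := ((hasDerivAt_id t).const_add 1).rpow_const (p := c)
        (Or.inl (by simp only [id]; linarith [ht.1]))
      have h₂ := ((hasDerivAt_id t).const_sub 1).rpow_const (p := c)
        (Or.inl (by simp only [id]; linarith [ht.2]))
      have h₃ := (hasDerivAt_id t).const_mul (2 * c)
      refine ((h₁.sub h₂).sub h₃).congr_deriv ?_
      simp only [id]
      ring
    refine monotoneOn_of_deriv_nonneg (convex_Ico 0 1)
      (fun t ht => (hderiv t ht).continuousAt.continuousWithinAt)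
      (fun t ht => (hderiv t (interior_subset ht)).differentiableAt.differentiableWithinAt)
      fun t ht => ?_
    have ht' := interior_subset ht
    rw [(hderiv t ht').deriv]
    have hu : 0 < 1 + t := by linarith [ht'.1]
    have hv : 0 < 1 - t := by linarith [ht'.2]
    -- The derivative is nonnegative by AM-GM: the two powers have product `(1 - t ^ 2) ^ (c - 1)`,
    -- which is at least 1.
    have hprod : 1 ≤ (1 + t) ^ (c - 1) * (1 - t) ^ (c - 1) := by
      rw [← mul_rpow hu.le hv.le]
      exact one_le_rpow_of_pos_of_le_one_of_nonpos (by positivity) (by nlinarith [sq_nonneg t])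
        (by linarith)
    have hx : 0 < (1 + t) ^ (c - 1) := by positivity
    have hy : 0 < (1 - t) ^ (c - 1) := by positivity
    have hsum : 2 ≤ (1 + t) ^ (c - 1) + (1 - t) ^ (c - 1) := by
      nlinarith [sq_nonneg ((1 + t) ^ (c - 1) - (1 - t) ^ (c - 1))]
    nlinarith
  have h := hmono (left_mem_Ico.2 one_pos) ⟨hb₀, hb₁⟩ hb₀
  simp at h
  linarith

/-- Compare derivatives in b: the odd part of a power is bounded by `mul_le_rpow_sub_rpow`, the
denominator by Bernoulli. The logarithm on the right is chosen so that `log Z ≤ Z - 1` yields the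
bound on the squared p-mean. -/
theorem rpow_add_rpow_le_log {p b : ℝ} (hp₀ : 0 < p) (hp₁ : p < 1) (hb₀ : 0 ≤ b) (hb₁ : b ≤ 1) :
    ((1 + b) ^ p + (1 - b) ^ p) / 2 - 1 ≤ p / 2 * log (1 - (1 - p) * b ^ 2) := by
  have hpos : ∀ t ∈ Icc (0 : ℝ) 1, 0 < 1 - (1 - p) * t ^ 2 := by
    intro t ht
    have : t ^ 2 ≤ 1 := by nlinarith [ht.1, ht.2]
    nlinarith
  have hmono : MonotoneOn (fun t : ℝ => p / 2 * log (1 - (1 - p) * t ^ 2)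
      - ((1 + t) ^ p + (1 - t) ^ p) / 2) (Icc 0 1) := by
    have hderiv : ∀ t ∈ Ioo (0 : ℝ) 1,
        HasDerivAt (fun t : ℝ => p / 2 * log (1 - (1 - p) * t ^ 2)
            - ((1 + t) ^ p + (1 - t) ^ p) / 2)
          (p / 2 * ((1 - t) ^ (p - 1) - (1 + t) ^ (p - 1)
            - 2 * (1 - p) * t / (1 - (1 - p) * t ^ 2))) t := by
      intro t ht
      have h₁ := ((hasDerivAt_id t).const_add 1).rpow_const (p := p)
        (Or.inl (by simp only [id]; linarith [ht.1]))
      have h₂ := ((hasDerivAt_id t).const_sub 1).rpow_const (p := p)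
        (Or.inl (by simp only [id]; linarith [ht.2]))
      have h₃ := ((((hasDerivAt_pow 2 t).const_mul (1 - p)).const_sub 1).log
        (hpos t (Ioo_subset_Icc_self ht)).ne').const_mul (p / 2)
      refine (h₃.sub ((h₁.add h₂).div_const 2)).congr_deriv ?_
      push_cast
      simp only [id]
      ring
    refine monotoneOn_of_deriv_nonneg (convex_Icc 0 1) ?_ ?_ ?_
    · refine ContinuousOn.sub (continuousOn_const.mul (ContinuousOn.log (by fun_prop) fun t ht =>
        (hpos t ht).ne')) (ContinuousOn.div_const (ContinuousOn.add ?_ ?_) 2)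
      · exact ContinuousOn.rpow_const (by fun_prop) fun _ _ => Or.inr hp₀.le
      · exact ContinuousOn.rpow_const (by fun_prop) fun _ _ => Or.inr hp₀.le
    · rw [interior_Icc]
      exact fun t ht => (hderiv t ht).differentiableAt.differentiableWithinAt
    · rw [interior_Icc]
      intro t ht
      rw [(hderiv t ht).deriv]
      have hu : 0 < 1 + t := by linarith [ht.1]
      have hv : 0 < 1 - t := by linarith [ht.2]
      have hw := hpos t (Ioo_subset_Icc_self ht)
      refine mul_nonneg (by positivity) (sub_nonneg.2 ?_)
      have hodd := mul_le_rpow_sub_rpow (c := 1 - p) (by linarith) (by linarith) ht.1.le ht.2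
      have hbern : (1 + t) ^ (1 - p) * (1 - t) ^ (1 - p) ≤ 1 - (1 - p) * t ^ 2 := by
        rw [← mul_rpow hu.le hv.le, show (1 + t) * (1 - t) = 1 + -t ^ 2 by ring]
        have := rpow_one_add_le_one_add_mul_self (s := -t ^ 2) (by nlinarith [ht.1, ht.2])
          (p := 1 - p) (by linarith) (by linarith)
        linarith
      have hx : 0 < (1 + t) ^ (1 - p) := by positivity
      have hy : 0 < (1 - t) ^ (1 - p) := by positivity
      rw [show p - 1 = -(1 - p) by ring, rpow_neg hu.le, rpow_neg hv.le,
        inv_sub_inv hy.ne' hx.ne']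
      have hnum : 0 ≤ 2 * (1 - p) * t := by nlinarith [ht.1]
      calc 2 * (1 - p) * t / (1 - (1 - p) * t ^ 2)
          ≤ 2 * (1 - p) * t / ((1 + t) ^ (1 - p) * (1 - t) ^ (1 - p)) := by gcongr
        _ ≤ ((1 + t) ^ (1 - p) - (1 - t) ^ (1 - p)) / ((1 + t) ^ (1 - p) * (1 - t) ^ (1 - p)) := by
          gcongr
        _ = _ := by rw [mul_comm ((1 + t) ^ (1 - p))]
  have h := hmono (left_mem_Icc.2 zero_le_one) ⟨hb₀, hb₁⟩ hb₀
  simp at h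
  linarith

/-- The `p`-mean of a function on two points. -/
noncomputable def twoPointNorm (p : ℝ) (φ : Bool → ℝ) : ℝ :=
  ((φ true ^ p + φ false ^ p) / 2) ^ (1 / p)

theorem twoPointNorm_nonneg (p : ℝ) {φ : Bool → ℝ} (hφ : ∀ b, 0 ≤ φ b) : 0 ≤ twoPointNorm p φ := by
  have h₁ := hφ true
  have h₂ := hφ false
  unfold twoPointNorm
  positivity

/-- By homogeneity the mean can be scaled to 1, so that the two values become 1 + t and 1 - t. -/
theorem rpow_mean_sq_le_of_le {p a b : ℝ} (hp₀ : 0 < p) (hp₁ : p < 1) (hb : 0 ≤ b) (hab : b ≤ a) :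
    (((a ^ p + b ^ p) / 2) ^ (1 / p)) ^ 2 ≤ ((a + b) / 2) ^ 2 - (1 - p) * ((a - b) / 2) ^ 2 := by
  rcases (hb.trans hab).eq_or_lt with ha | ha
  · have hb0 : b = 0 := by linarith
    subst hb0
    rw [← ha]
    simp [zero_rpow hp₀.ne', hp₀.ne']
  set s := (a + b) / 2 with hs
  have hs₀ : 0 < s := by linarith
  obtain ⟨t, ht⟩ : ∃ t, t = (a - b) / 2 / s := ⟨_, rfl⟩
  have hts : s * t = (a - b) / 2 := by rw [ht]; field_simp
  have ht₀ : 0 ≤ t := by rw [ht]; exact div_nonneg (by linarith) hs₀.le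
  have ht₁ : t ≤ 1 := by rw [ht, div_le_one hs₀]; linarith
  have ha' : a = s * (1 + t) := by rw [mul_add, hts]; linarith
  have hb' : b = s * (1 - t) := by rw [mul_sub, hts]; linarith
  have hw : 0 < 1 - (1 - p) * t ^ 2 := by nlinarith [mul_nonneg ht₀ (sub_nonneg.2 ht₁)]
  have hlog := rpow_add_rpow_le_log hp₀ hp₁ ht₀ ht₁
  have hZ : 0 < ((1 + t) ^ p + (1 - t) ^ p) / 2 := by
    have h₁ : 0 < (1 + t) ^ p := by positivity
    have h₂ : 0 ≤ (1 - t) ^ p := rpow_nonneg (by linarith) p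
    linarith
  have hZ' : ((((1 + t) ^ p + (1 - t) ^ p) / 2) ^ (1 / p)) ^ 2 ≤ 1 - (1 - p) * t ^ 2 := by
    rw [← log_le_log_iff (by positivity) hw, log_pow, log_rpow hZ]
    have h₁ := log_le_sub_one_of_pos hZ
    have h₂ := h₁.trans hlog
    rw [show ((2 : ℕ) : ℝ) * (1 / p * log (((1 + t) ^ p + (1 - t) ^ p) / 2))
      = log (((1 + t) ^ p + (1 - t) ^ p) / 2) / (p / 2) by push_cast; field_simp,
      div_le_iff₀ (by positivity)]
    linarith
  have hfac : ((a ^ p + b ^ p) / 2) ^ (1 / p)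
      = s * (((1 + t) ^ p + (1 - t) ^ p) / 2) ^ (1 / p) := by
    rw [ha', hb', mul_rpow hs₀.le (by linarith), mul_rpow hs₀.le (by linarith), ← mul_add,
      mul_div_assoc, mul_rpow (by positivity) hZ.le, ← rpow_mul hs₀.le, mul_one_div_cancel hp₀.ne',
      rpow_one]
  rw [hfac, mul_pow, ← hts]
  nlinarith [mul_le_mul_of_nonneg_left hZ' (sq_nonneg s)]

theorem twoPointNorm_sq_le {p : ℝ} (hp₀ : 0 < p) (hp₁ : p < 1) {φ : Bool → ℝ}
    (hφ : ∀ b, 0 ≤ φ b) :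
    twoPointNorm p φ ^ 2 ≤
      ((φ true + φ false) / 2) ^ 2 - (1 - p) * ((φ true - φ false) / 2) ^ 2 := by
  unfold twoPointNorm
  rcases le_total (φ false) (φ true) with h | h
  · exact rpow_mean_sq_le_of_le hp₀ hp₁ (hφ _) h
  · have := rpow_mean_sq_le_of_le hp₀ hp₁ (hφ _) h
    rw [add_comm (φ true ^ p)]
    linarith

/-- The correlation of two functions of the preferences of a uniform random voter on two adjacent
pairs of a cyclic triple of alternatives. -/
noncomputable def voterCorr (φ γ : Bool → ℝ) : ℝ :=
  (φ true * γ true + φ false * γ false + 2 * (φ true * γ false) + 2 * (φ false * γ true)) / 6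

/-- The two-point case of the reverse hypercontractive inequality. -/
theorem twoPointNorm_mul_le_voterCorr {p q : ℝ} (hp₀ : 0 < p) (hp₁ : p < 1) (hq₀ : 0 < q)
    (hq₁ : q < 1) (hpq : (1 - p) * (1 - q) = 1 / 9) {φ γ : Bool → ℝ} (hφ : ∀ b, 0 ≤ φ b)
    (hγ : ∀ b, 0 ≤ γ b) :
    twoPointNorm p φ * twoPointNorm q γ ≤ voterCorr φ γ := by
  have h₁ := twoPointNorm_sq_le hp₀ hp₁ hφ
  have h₂ := twoPointNorm_sq_le hq₀ hq₁ hγ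
  have hcorr : 0 ≤ voterCorr φ γ := by
    have := mul_nonneg (hφ true) (hγ true)
    have := mul_nonneg (hφ true) (hγ false)
    have := mul_nonneg (hφ false) (hγ true)
    have := mul_nonneg (hφ false) (hγ false)
    unfold voterCorr
    positivity
  refine le_of_sq_le_sq ?_ hcorr
  rw [mul_pow]
  refine (mul_le_mul h₁ h₂ (sq_nonneg _) ((sq_nonneg _).trans h₁)).trans ?_
  set s := (φ true + φ false) / 2 with hs
  set d := (φ true - φ false) / 2 with hd
  set t := (γ true + γ false) / 2 with ht
  set e := (γ true - γ false) / 2 with he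
  have hst : voterCorr φ γ = s * t - d * e / 3 := by
    rw [hs, hd, ht, he]
    unfold voterCorr
    ring
  have hx : √(1 - p) ^ 2 = 1 - p := sq_sqrt (by linarith)
  have hy : √(1 - q) ^ 2 = 1 - q := sq_sqrt (by linarith)
  have hxy : √(1 - p) * √(1 - q) = 1 / 3 := by
    rw [← sqrt_mul (by linarith), hpq, show (1 / 9 : ℝ) = (1 / 3) ^ 2 by norm_num,
      sqrt_sq (by norm_num)]
  rw [hst]
  -- The squared correlation minus the product of the two quadratic bounds is exactly this square;
  -- the `d ^ 2 * e ^ 2` terms cancel because `(1 - p) * (1 - q) = 1 / 9`.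
  have hkey := sq_nonneg (s * √(1 - q) * e - t * √(1 - p) * d)
  have : (s * √(1 - q) * e - t * √(1 - p) * d) ^ 2 = s ^ 2 * (1 - q) * e ^ 2
      + t ^ 2 * (1 - p) * d ^ 2 - 2 / 3 * (s * t * d * e) := by
    linear_combination (s ^ 2 * e ^ 2) * hy + t ^ 2 * d ^ 2 * hx - 2 * s * t * d * e * hxy
  rw [this] at hkey
  linear_combination hkey + d ^ 2 * e ^ 2 * hpq

/-- The two-point case of the hypercontractive inequality for the exponents `10 / 9` and `2`. -/
theorem voterCorr_le_twoPointNorm_mul {φ γ : Bool → ℝ} (hφ : ∀ b, 0 ≤ φ b) (hγ : ∀ b, 0 ≤ γ b) :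
    voterCorr φ γ ≤ twoPointNorm (10 / 9) φ * twoPointNorm 2 γ := by
  have h₁ := hφ true
  have h₂ := hφ false
  have h₃ := hγ true
  have h₄ := hγ false
  -- u and v are the conditional expectations of γ given the first preference. By Hölder with
  -- exponents 10/9 and 10, it remains to bound their 10-mean by the 2-mean of γ.
  obtain ⟨u, hu⟩ : ∃ u, u = (γ true + 2 * γ false) / 3 := ⟨_, rfl⟩
  obtain ⟨v, hv⟩ : ∃ v, v = (γ false + 2 * γ true) / 3 := ⟨_, rfl⟩
  have hu₀ : 0 ≤ u := by rw [hu]; positivity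
  have hv₀ : 0 ≤ v := by rw [hv]; positivity
  have hpoly : (u ^ 10 + v ^ 10) / 2 ≤ ((γ true ^ 2 + γ false ^ 2) / 2) ^ 5 := by
    obtain ⟨s, hs⟩ : ∃ s, s = (γ true + γ false) / 2 := ⟨_, rfl⟩
    obtain ⟨e, he⟩ : ∃ e, e = (γ true - γ false) / 2 := ⟨_, rfl⟩
    have hu' : u = s - e / 3 := by rw [hu, hs, he]; ring
    have hv' : v = s + e / 3 := by rw [hv, hs, he]; ring
    have hsq : (γ true ^ 2 + γ false ^ 2) / 2 = s ^ 2 + e ^ 2 := by rw [hs, he]; ring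
    rw [hu', hv', hsq, ← sub_nonneg]
    -- The `s ^ 8 * e ^ 2` terms cancel, since 45 / 9 = 5; all remaining coefficients are positive.
    have : (s ^ 2 + e ^ 2) ^ 5 - ((s - e / 3) ^ 10 + (s + e / 3) ^ 10) / 2
        = (10 - 210 / 81) * (s ^ 6 * e ^ 4) + (10 - 210 / 729) * (s ^ 4 * e ^ 6)
          + (5 - 45 / 6561) * (s ^ 2 * e ^ 8) + (1 - 1 / 59049) * e ^ 10 := by ring
    rw [this]
    have := (by decide : Even 6).pow_nonneg s
    positivity
  have hholder := inner_le_Lp_mul_Lq_of_nonneg (Finset.univ : Finset Bool) (p := 10 / 9) (q := 10)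
    (f := φ) (g := fun b => cond b u v) (by constructor <;> norm_num)
    (fun b _ => hφ b) (fun b _ => by cases b <;> assumption)
  simp only [Fintype.sum_bool, cond_true, cond_false] at hholder
  have hnorm : twoPointNorm (10 / 9) φ * ((u ^ (10 : ℝ) + v ^ (10 : ℝ)) / 2) ^ (1 / 10 : ℝ)
      = (φ true ^ (10 / 9 : ℝ) + φ false ^ (10 / 9 : ℝ)) ^ (1 / (10 / 9) : ℝ)
        * (u ^ (10 : ℝ) + v ^ (10 : ℝ)) ^ (1 / 10 : ℝ) / 2 := by
    unfold twoPointNorm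
    rw [div_rpow (by positivity) (by norm_num), div_rpow (by positivity) (by norm_num),
      div_mul_div_comm, ← rpow_add (by norm_num)]
    norm_num
  have hlast : ((u ^ (10 : ℝ) + v ^ (10 : ℝ)) / 2) ^ (1 / 10 : ℝ) ≤ twoPointNorm 2 γ := by
    have hcast : ∀ x : ℝ, x ^ (10 : ℝ) = x ^ 10 := fun x => by
      rw [← rpow_natCast]; norm_num
    have hsq : twoPointNorm 2 γ = (((γ true ^ 2 + γ false ^ 2) / 2) ^ 5) ^ (1 / 10 : ℝ) := by
      unfold twoPointNorm
      rw [← rpow_natCast _ 5, ← rpow_mul (by positivity)]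
      norm_num
    rw [hcast, hcast, hsq]
    exact rpow_le_rpow (by positivity) hpoly (by norm_num)
  calc voterCorr φ γ = (φ true * u + φ false * v) / 2 := by
        rw [hu, hv]; unfold voterCorr; ring
    _ ≤ _ := by rw [div_le_div_iff_of_pos_right (by norm_num)]; exact hholder
    _ = _ := hnorm.symm
    _ ≤ _ := mul_le_mul_of_nonneg_left hlast (twoPointNorm_nonneg _ hφ)

/-! ### Means on product spaces and tensorization -/

/-- The mean of a function on `βⁿ`. -/
noncomputable def piMean {β : Type*} [Fintype β] {n : ℕ} (f : (Fin n → β) → ℝ) : ℝ :=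
  (∑ x, f x) / (Fintype.card β : ℝ) ^ n

section piMean

variable {β : Type*} [Fintype β] {n : ℕ}

theorem piMean_nonneg {f : (Fin n → β) → ℝ} (hf : ∀ x, 0 ≤ f x) : 0 ≤ piMean f :=
  div_nonneg (Finset.sum_nonneg fun x _ => hf x) (by positivity)

theorem piMean_mono {f g : (Fin n → β) → ℝ} (h : ∀ x, f x ≤ g x) : piMean f ≤ piMean g := by
  unfold piMean
  gcongr
  exact h _

theorem piMean_add (f g : (Fin n → β) → ℝ) :
    piMean (fun x => f x + g x) = piMean f + piMean g := by
  simp only [piMean, Finset.sum_add_distrib, add_div]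

theorem piMean_sub (f g : (Fin n → β) → ℝ) :
    piMean (fun x => f x - g x) = piMean f - piMean g := by
  simp only [piMean, Finset.sum_sub_distrib, sub_div]

theorem piMean_const [Nonempty β] (c : ℝ) : piMean (fun _ : Fin n → β => c) = c := by
  simp [piMean]

theorem piMean_zero (f : (Fin 0 → β) → ℝ) (x : Fin 0 → β) : piMean f = f x := by
  simp only [piMean, Fintype.sum_unique, pow_zero, div_one]
  exact congrArg f (Subsingleton.elim _ _)

theorem piMean_succ (f : (Fin (n + 1) → β) → ℝ) :
    piMean f = (∑ b, piMean fun x => f (Fin.cons b x)) / Fintype.card β := by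
  unfold piMean
  rw [← Finset.sum_div, div_div, ← pow_succ, ← Fintype.sum_prod_type',
    ← (Fin.consEquiv fun _ : Fin (n + 1) => β).sum_comp]
  rfl

end piMean

/-- The `p`-mean of a function on the discrete cube. -/
noncomputable def cubeNorm {n : ℕ} (p : ℝ) (f : (Fin n → Bool) → ℝ) : ℝ :=
  piMean (fun x => f x ^ p) ^ (1 / p)

theorem cubeNorm_nonneg {n : ℕ} (p : ℝ) {f : (Fin n → Bool) → ℝ} (hf : ∀ x, 0 ≤ f x) :
    0 ≤ cubeNorm p f :=
  rpow_nonneg (piMean_nonneg fun x => rpow_nonneg (hf x) p) _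

theorem cubeNorm_succ {n : ℕ} {p : ℝ} (hp : 0 < p) {f : (Fin (n + 1) → Bool) → ℝ}
    (hf : ∀ x, 0 ≤ f x) :
    cubeNorm p f = twoPointNorm p fun b => cubeNorm p fun x => f (Fin.cons b x) := by
  have h : ∀ b, (cubeNorm p fun x => f (Fin.cons b x)) ^ p
      = piMean fun x => f (Fin.cons b x) ^ p := fun b => by
    unfold cubeNorm
    rw [← rpow_mul (piMean_nonneg fun x => rpow_nonneg (hf _) p), one_div_mul_cancel hp.ne',
      rpow_one]
  unfold twoPointNorm
  rw [h, h, cubeNorm, piMean_succ, Fintype.sum_bool]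
  simp

theorem cubeNorm_zero {p : ℝ} (hp : 0 < p) {f : (Fin 0 → Bool) → ℝ} (hf : ∀ x, 0 ≤ f x)
    (x : Fin 0 → Bool) : cubeNorm p f = f x := by
  rw [cubeNorm, piMean_zero _ x, ← rpow_mul (hf _), mul_one_div_cancel hp.ne', rpow_one]

section tensorization

variable {α : Type*} [Fintype α] {π₁ π₂ : α → Bool} {p q : ℝ}

/-- Induction on the number of voters: the one-voter inequality is applied to the norms of the
restrictions to the first coordinate, and the induction hypothesis to each pair of restrictions. -/
theorem cubeNorm_mul_le_piMean (hp : 0 < p) (hq : 0 < q)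
    (h : ∀ φ γ : Bool → ℝ, (∀ b, 0 ≤ φ b) → (∀ b, 0 ≤ γ b) →
      twoPointNorm p φ * twoPointNorm q γ ≤ (∑ σ, φ (π₁ σ) * γ (π₂ σ)) / Fintype.card α)
    {n : ℕ} {f g : (Fin n → Bool) → ℝ} (hf : ∀ x, 0 ≤ f x) (hg : ∀ x, 0 ≤ g x) :
    cubeNorm p f * cubeNorm q g ≤ piMean fun X : Fin n → α => f (π₁ ∘ X) * g (π₂ ∘ X) := by
  induction n with
  | zero =>
    rw [piMean_zero _ Fin.elim0, cubeNorm_zero hp hf, cubeNorm_zero hq hg]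
  | succ n ih =>
    rw [cubeNorm_succ hp hf, cubeNorm_succ hq hg, piMean_succ]
    refine (h _ _ (fun b => cubeNorm_nonneg p fun _ => hf _)
      fun b => cubeNorm_nonneg q fun _ => hg _).trans ?_
    gcongr with σ
    refine (ih (fun _ => hf _) fun _ => hg _).trans_eq ?_
    simp only [Fin.comp_cons]

theorem piMean_le_cubeNorm_mul (hp : 0 < p) (hq : 0 < q)
    (h : ∀ φ γ : Bool → ℝ, (∀ b, 0 ≤ φ b) → (∀ b, 0 ≤ γ b) →
      (∑ σ, φ (π₁ σ) * γ (π₂ σ)) / Fintype.card α ≤ twoPointNorm p φ * twoPointNorm q γ)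
    {n : ℕ} {f g : (Fin n → Bool) → ℝ} (hf : ∀ x, 0 ≤ f x) (hg : ∀ x, 0 ≤ g x) :
    (piMean fun X : Fin n → α => f (π₁ ∘ X) * g (π₂ ∘ X)) ≤ cubeNorm p f * cubeNorm q g := by
  induction n with
  | zero =>
    rw [piMean_zero _ Fin.elim0, cubeNorm_zero hp hf, cubeNorm_zero hq hg]
  | succ n ih =>
    rw [cubeNorm_succ hp hf, cubeNorm_succ hq hg, piMean_succ]
    refine le_trans ?_ (h _ _ (fun b => cubeNorm_nonneg p fun _ => hf _)
      fun b => cubeNorm_nonneg q fun _ => hg _)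
    gcongr with σ
    refine le_trans (le_of_eq ?_) (ih (fun _ => hf _) fun _ => hg _)
    simp only [Fin.comp_cons]

end tensorization

/-! ### Correlations of choices on adjacent cyclic pairs -/

/-- The real-valued indicator function of the event `f = s`. -/
noncomputable def levelInd {n : ℕ} (f : (Fin n → Bool) → Bool) (s : Bool) (x : Fin n → Bool) : ℝ :=
  if f x = s then 1 else 0

section levelInd

variable {n : ℕ} (f g : (Fin n → Bool) → Bool) (s t : Bool)

theorem levelInd_nonneg (x : Fin n → Bool) : 0 ≤ levelInd f s x := by
  unfold levelInd; split <;> norm_num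

theorem levelInd_le_one (x : Fin n → Bool) : levelInd f s x ≤ 1 := by
  unfold levelInd; split <;> norm_num

theorem levelInd_not (x : Fin n → Bool) : levelInd f (!s) x = 1 - levelInd f s x := by
  unfold levelInd; cases f x <;> cases s <;> simp

theorem piMean_levelInd_not : piMean (levelInd f (!s)) = 1 - piMean (levelInd f s) := by
  rw [funext (levelInd_not f s), piMean_sub, piMean_const]

theorem piMean_levelInd_nonneg : 0 ≤ piMean (levelInd f s) :=
  piMean_nonneg (levelInd_nonneg f s)

theorem cubeNorm_levelInd {p : ℝ} (hp : 0 < p) :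
    cubeNorm p (levelInd f s) = piMean (levelInd f s) ^ (1 / p) := by
  unfold cubeNorm
  congr 2
  funext x
  unfold levelInd
  split <;> simp [hp.ne']

end levelInd

theorem expect_eq_piMean {n : ℕ} (f : (Fin n → Bool) → Bool) :
    expect f = piMean (levelInd f true) := by
  simp [expect, piMean, levelInd]

/-- The preferences of the voters between `i` and the cyclically next alternative. -/
def cycPref {n : ℕ} (i : Fin 3) (X : Profile 3 n) : Fin n → Bool :=
  fun v => voterPrefers (X v) i (i + 1)

theorem voterCorr_comm (φ γ : Bool → ℝ) : voterCorr φ γ = voterCorr γ φ := by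
  unfold voterCorr
  ring

theorem cycPref_succ {n : ℕ} (i : Fin 3) (X : Profile 3 n) :
    cycPref (i + 1) X = fun v => voterPrefers (X v) (i + 1) (i + 2) := by
  unfold cycPref
  rw [add_assoc]
  rfl

theorem sum_voterPrefers (i : Fin 3) (φ γ : Bool → ℝ) :
    (∑ σ : Ranking 3, φ (voterPrefers σ i (i + 1)) * γ (voterPrefers σ (i + 1) (i + 2)))
      / Fintype.card (Ranking 3) = voterCorr φ γ := by
  have hcard : Fintype.card (Ranking 3) = 6 := by decide
  -- Two equal cyclic preferences determine the ranking; two different ones leave two rankings.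
  have hcount : ∀ i : Fin 3, ∀ s t : Bool, (Finset.univ.filter fun σ : Ranking 3 =>
      (voterPrefers σ i (i + 1), voterPrefers σ (i + 1) (i + 2)) = (s, t)).card
        = if s = t then 1 else 2 := by decide
  rw [hcard, ← Finset.sum_fiberwise (s := Finset.univ)
    (g := fun σ : Ranking 3 => (voterPrefers σ i (i + 1), voterPrefers σ (i + 1) (i + 2)))]
  have hfib : ∀ z : Bool × Bool, (∑ σ : Ranking 3 with
      (voterPrefers σ i (i + 1), voterPrefers σ (i + 1) (i + 2)) = z,
        φ (voterPrefers σ i (i + 1)) * γ (voterPrefers σ (i + 1) (i + 2)))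
      = (if z.1 = z.2 then 1 else 2) * (φ z.1 * γ z.2) := by
    rintro ⟨s, t⟩
    rw [Finset.sum_congr rfl (g := fun _ => φ s * γ t), Finset.sum_const, hcount, nsmul_eq_mul]
    · split <;> simp
    · intro σ hσ
      obtain ⟨h₁, h₂⟩ := Prod.mk.inj (Finset.mem_filter.1 hσ).2
      rw [h₁, h₂]
  simp only [hfib, Fintype.sum_prod_type, Fintype.sum_bool, voterCorr]
  simp
  ring

/-- The reverse hypercontractive inequality for two Boolean functions of the preferences of the
voters on adjacent pairs of alternatives. -/
theorem rpow_mul_rpow_le_piMean {p q : ℝ} (hp₀ : 0 < p) (hp₁ : p < 1) (hq₀ : 0 < q)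
    (hq₁ : q < 1) (hpq : (1 - p) * (1 - q) = 1 / 9) {n : ℕ} (i : Fin 3)
    (f g : (Fin n → Bool) → Bool) (s t : Bool) :
    piMean (levelInd f s) ^ (1 / p) * piMean (levelInd g t) ^ (1 / q) ≤
      piMean fun X : Profile 3 n => levelInd f s (cycPref i X) * levelInd g t (cycPref (i + 1) X) := by
  rw [← cubeNorm_levelInd f s hp₀, ← cubeNorm_levelInd g t hq₀]
  refine (cubeNorm_mul_le_piMean (α := Ranking 3) (π₁ := fun σ => voterPrefers σ i (i + 1))
    (π₂ := fun σ => voterPrefers σ (i + 1) (i + 2)) hp₀ hq₀ (fun φ γ hφ hγ => ?_)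
    (levelInd_nonneg f s) (levelInd_nonneg g t)).trans_eq ?_
  · rw [sum_voterPrefers]
    exact twoPointNorm_mul_le_voterCorr hp₀ hp₁ hq₀ hq₁ hpq hφ hγ
  · simp only [cycPref_succ]
    rfl

/-- The hypercontractive inequality for two Boolean functions of the preferences of the voters on
adjacent pairs of alternatives. -/
theorem piMean_le_rpow_mul_rpow {n : ℕ} (i : Fin 3) (f g : (Fin n → Bool) → Bool) (s t : Bool) :
    (piMean fun X : Profile 3 n => levelInd f s (cycPref i X) * levelInd g t (cycPref (i + 1) X)) ≤
      piMean (levelInd f s) ^ (0.9 : ℝ) * piMean (levelInd g t) ^ (0.5 : ℝ) := by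
  rw [show (0.9 : ℝ) = 1 / (10 / 9) by norm_num, show (0.5 : ℝ) = 1 / 2 by norm_num,
    ← cubeNorm_levelInd f s (by norm_num), ← cubeNorm_levelInd g t (by norm_num)]
  refine le_trans (le_of_eq ?_) (piMean_le_cubeNorm_mul (α := Ranking 3)
    (π₁ := fun σ => voterPrefers σ i (i + 1)) (π₂ := fun σ => voterPrefers σ (i + 1) (i + 2))
    (by norm_num) (by norm_num) (fun φ γ hφ hγ => ?_)
    (levelInd_nonneg f s) (levelInd_nonneg g t))
  · simp only [cycPref_succ]
    rfl
  · rw [sum_voterPrefers]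
    exact voterCorr_le_twoPointNorm_mul hφ hγ

theorem piMean_le_rpow_mul_rpow_swap {n : ℕ} (i : Fin 3) (f g : (Fin n → Bool) → Bool)
    (s t : Bool) :
    (piMean fun X : Profile 3 n => levelInd f s (cycPref i X) * levelInd g t (cycPref (i + 1) X)) ≤
      piMean (levelInd g t) ^ (0.9 : ℝ) * piMean (levelInd f s) ^ (0.5 : ℝ) := by
  rw [show (0.9 : ℝ) = 1 / (10 / 9) by norm_num, show (0.5 : ℝ) = 1 / 2 by norm_num,
    ← cubeNorm_levelInd f s (by norm_num), ← cubeNorm_levelInd g t (by norm_num), mul_comm]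
  refine le_trans (le_of_eq ?_) (piMean_le_cubeNorm_mul (α := Ranking 3)
    (π₁ := fun σ => voterPrefers σ i (i + 1)) (π₂ := fun σ => voterPrefers σ (i + 1) (i + 2))
    (by norm_num) (by norm_num) (fun φ γ hφ hγ => ?_)
    (levelInd_nonneg f s) (levelInd_nonneg g t))
  · simp only [cycPref_succ]
    rfl
  · rw [sum_voterPrefers, voterCorr_comm, mul_comm]
    exact voterCorr_le_twoPointNorm_mul hγ hφ

/-- The preferences of a uniform random profile on a pair of alternatives are uniform. -/
theorem piMean_comp_cycPref {n : ℕ} (i : Fin 3) (f : (Fin n → Bool) → ℝ) :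
    (piMean fun X : Profile 3 n => f (cycPref i X)) = piMean f := by
  induction n with
  | zero => rw [piMean_zero _ Fin.elim0, piMean_zero f]
  | succ n ih =>
    have hcons : ∀ (σ : Ranking 3) (X : Profile 3 n),
        cycPref i (Fin.cons σ X : Profile 3 (n + 1))
          = Fin.cons (voterPrefers σ i (i + 1)) (cycPref i X) := fun σ X =>
      Fin.comp_cons (fun σ => voterPrefers σ i (i + 1)) σ X
    rw [piMean_succ, piMean_succ]
    simp only [hcons]
    rw [Finset.sum_congr rfl fun σ _ => ih fun x => f (Fin.cons (voterPrefers σ i (i + 1)) x)]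
    -- A constant second function turns the correlation into the marginal mean.
    have h := sum_voterPrefers i (fun b => piMean fun x => f (Fin.cons b x)) fun _ => 1
    simp only [mul_one] at h
    rw [h, Fintype.sum_bool, voterCorr, Fintype.card_bool]
    push_cast
    ring

/-! ### Numerical comparison of the correlation bounds -/

theorem RHC_self {x : ℝ} (hx₀ : 0 ≤ x) : RHC x x = x ^ 3 := by
  unfold RHC
  rcases hx₀.eq_or_lt with rfl | hx
  · simp
  by_cases h₁ : x = 1
  · simp [h₁]
  · have hlog : logb x x = 1 := by
      unfold logb
      exact div_self (log_ne_zero_of_pos_of_ne_one hx h₁)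
    rw [if_neg (by simp [hx.ne']), if_neg h₁, hlog, sqrt_one]
    norm_num
    ring

/-- `RHC(ε, 1/2)` arises from admissible exponents of the reverse hypercontractive inequality. -/
theorem exists_exponents_RHC {ε : ℝ} (hε₀ : 0 < ε) (hε : ε ≤ (2 : ℝ) ^ (-500000 : ℝ)) :
    ∃ p q : ℝ, 0 < p ∧ p < 1 ∧ 0 < q ∧ q < 1 ∧ (1 - p) * (1 - q) = 1 / 9 ∧
      1 / p ≤ 1.126 ∧ ε ^ (0.001 : ℝ) ≤ (1 / 2) ^ (1 / q) ∧
      RHC ε (1 / 2) = ε ^ (1 / p) * (1 / 2) ^ (1 / q) := by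
  obtain ⟨L, hL⟩ : ∃ L, L = -logb 2 ε := ⟨_, rfl⟩
  have hεL : ε = 2 ^ (-L) := by
    rw [hL, neg_neg, rpow_logb (by norm_num) (by norm_num) hε₀]
  have hL₀ : 500000 ≤ L := by
    rw [hεL, rpow_le_rpow_left_iff (by norm_num)] at hε
    linarith
  obtain ⟨s, hs⟩ : ∃ s, s = √L := ⟨_, rfl⟩
  have hsL : s ^ 2 = L := by rw [hs]; exact sq_sqrt (by linarith)
  -- Large enough for both `3 / (8 * s) ≤ 0.001` and `(9 + 3 * s) / 8 ≤ 0.001 * s ^ 2`, which the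
  -- two estimates on the exponents need.
  have hs₀ : 600 ≤ s := by rw [hs]; exact le_sqrt_of_sq_le (by linarith)
  have hhalf : ∀ z : ℝ, (1 / 2 : ℝ) ^ z = 2 ^ (-z) := fun z => by
    rw [one_div, inv_rpow (by norm_num), rpow_neg (by norm_num)]
  refine ⟨8 * s / (9 * s + 3), 8 / (9 + 3 * s), by positivity, ?_, by positivity, ?_, ?_, ?_, ?_, ?_⟩
  · rw [div_lt_one (by positivity)]; linarith
  · rw [div_lt_one (by positivity)]; linarith
  · field_simp; ring
  · rw [one_div_div, div_le_iff₀ (by positivity)]; linarith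
  · rw [hεL, hhalf, ← rpow_mul (by norm_num), rpow_le_rpow_left_iff (by norm_num), one_div_div]
    nlinarith
  · have hε₁ : ε ≠ 1 := by
      intro h
      rw [h] at hL
      simp at hL
      linarith
    have hlog : logb ε (1 / 2) = 1 / s ^ 2 := by
      have h2 : log 2 ≠ 0 := (log_pos (by norm_num)).ne'
      rw [hsL, logb, hεL, log_rpow (by norm_num), one_div, log_inv]
      field_simp
    rw [RHC, if_neg (by simp [hε₀.ne']), if_neg hε₁, hlog, sqrt_div zero_le_one, sqrt_one,
      sqrt_sq (by linarith), hhalf]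
    nth_rw 1 [← rpow_one ε]
    rw [← rpow_add hε₀, hεL, ← rpow_mul (by norm_num), ← rpow_mul (by norm_num),
      ← rpow_add (by norm_num), ← hsL]
    congr 1
    field_simp
    ring

theorem RHC_half_le {ε : ℝ} (hε₀ : 0 ≤ ε) (hε : ε ≤ (2 : ℝ) ^ (-500000 : ℝ)) :
    RHC ε (1 / 2) ≤ ε := by
  have hε₁ : ε < 1 := hε.trans_lt (rpow_lt_one_of_one_lt_of_neg (by norm_num) (by norm_num))
  unfold RHC
  split
  · exact hε₀
  · rw [if_neg hε₁.ne]
    exact mul_le_of_le_one_right hε₀ (rpow_le_one hε₀ hε₁.le (by positivity))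

/-- A small enough number raised to an explicit positive power is below `1 / 100`. -/
theorem rpow_le_one_div_hundred {x e : ℝ} (hx₀ : 0 < x) (hx : x ≤ (2 : ℝ) ^ (-1000 : ℝ))
    (he : 0.01 ≤ e) : x ^ e ≤ 1 / 100 := by
  calc x ^ e ≤ ((2 : ℝ) ^ (-1000 : ℝ)) ^ e := rpow_le_rpow hx₀.le hx (by linarith)
    _ = 2 ^ (-1000 * e) := (rpow_mul (by norm_num) _ _).symm
    _ ≤ 2 ^ (-7 : ℝ) := rpow_le_rpow_of_exponent_le (by norm_num) (by linarith)
    _ ≤ 1 / 100 := by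
      rw [rpow_neg (by norm_num)]
      norm_num

theorem rpow_le_div_hundred_mul_rpow {x a b : ℝ} (hx₀ : 0 < x) (hx : x ≤ (2 : ℝ) ^ (-1000 : ℝ))
    (hab : b + 0.01 ≤ a) : x ^ a ≤ 1 / 100 * x ^ b := by
  rw [← sub_add_cancel a b, rpow_add hx₀]
  gcongr
  exact rpow_le_one_div_hundred hx₀ hx (by linarith)

/-- Here `ε`, `q`, `r` stand for the measures of three events `f`, `g`, `h`, and `A`, `B`, `C` for
the probabilities of `f ∧ h`, `g ∧ h`, `f ∧ g`. -/
theorem max_le_of_correlation_bounds_of_le {ε q r A B C : ℝ} (hε₀ : 0 ≤ ε)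
    (hε : ε ≤ (2 : ℝ) ^ (-500000 : ℝ)) (hεq : ε ≤ q) (hqr : q ≤ r)
    (hAε : A ≤ ε) (hCε : C ≤ ε) (hA : A ≤ ε ^ (0.9 : ℝ) * r ^ (0.5 : ℝ))
    (hC : C ≤ ε ^ (0.9 : ℝ) * q ^ (0.5 : ℝ))
    (hB : ∀ a b : ℝ, 0 < a → a < 1 → 0 < b → b < 1 → (1 - a) * (1 - b) = 1 / 9 →
      q ^ (1 / a) * r ^ (1 / b) ≤ B)
    (hA' : ∀ a b : ℝ, 0 < a → a < 1 → 0 < b → b < 1 → (1 - a) * (1 - b) = 1 / 9 →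
      ε ^ (1 / a) * (1 - r) ^ (1 / b) ≤ ε - A) :
    max (q ^ 3) (RHC ε (1 / 2)) ≤ 10 * (ε + B - A - C) := by
  have hq₀ : 0 ≤ q := hε₀.trans hεq
  have hr₀ : 0 ≤ r := hq₀.trans hqr
  have hRε := RHC_half_le hε₀ hε
  have hB' : q ^ (1.5 : ℝ) * r ^ (1.5 : ℝ) ≤ B := by
    have := hB (2 / 3) (2 / 3) (by norm_num) (by norm_num) (by norm_num) (by norm_num) (by norm_num)
    norm_num at this ⊢
    exact this
  have hB3 : q ^ 3 ≤ B := by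
    refine le_trans ?_ hB'
    calc q ^ 3 = q ^ (1.5 : ℝ) * q ^ (1.5 : ℝ) := by
          rw [← rpow_add_of_nonneg hq₀ (by norm_num) (by norm_num), ← rpow_natCast]
          norm_num
      _ ≤ _ := by gcongr
  -- If `q ^ 3 ≥ 2 * ε`, then A, C ≤ ε leaves at least B - ε ≥ `q ^ 3 / 2`. Otherwise ε is positive
  -- and q is tiny.
  rcases le_or_gt (2 * ε) (q ^ 3) with hcase | hcase
  · exact max_le (by linarith) (by linarith)
  have hε_pos : 0 < ε := by nlinarith [pow_nonneg hq₀ 3]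
  have hq_pos : 0 < q := hε_pos.trans_le hεq
  have hε_small : ε ≤ (2 : ℝ) ^ (-1000 : ℝ) :=
    hε.trans (rpow_le_rpow_of_exponent_le (by norm_num) (by norm_num))
  have hq_le : q ≤ (2 * ε) ^ (1 / 3 : ℝ) := by
    calc q = (q ^ 3) ^ (1 / 3 : ℝ) := by
          rw [← rpow_natCast, ← rpow_mul hq₀]
          norm_num
      _ ≤ (2 * ε) ^ (1 / 3 : ℝ) := by gcongr
  have hq_small : q ≤ (2 : ℝ) ^ (-1000 : ℝ) := by
    refine hq_le.trans ?_
    calc (2 * ε) ^ (1 / 3 : ℝ) ≤ (2 * (2 : ℝ) ^ (-500000 : ℝ)) ^ (1 / 3 : ℝ) := by gcongr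
      _ = 2 ^ ((1 + -500000) * (1 / 3) : ℝ) := by
        rw [rpow_mul (by norm_num), rpow_add (by norm_num), rpow_one]
      _ ≤ _ := rpow_le_rpow_of_exponent_le (by norm_num) (by norm_num)
  obtain ⟨a, b, ha₀, ha₁, hb₀, hb₁, hab, ha, hb, hR⟩ := exists_exponents_RHC hε_pos hε
  have hε₁ : ε ≤ 1 := hε_small.trans (rpow_le_one_of_one_le_of_nonpos (by norm_num) (by norm_num))
  have hq₁ : q ≤ 1 := hq_small.trans (rpow_le_one_of_one_le_of_nonpos (by norm_num) (by norm_num))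
  have ha1 : 0 < 1 / a := by positivity
  have hb1 : 0 < 1 / b := by positivity
  -- For large r, B alone dominates both targets and A is absorbed by ε. For r < 1/2, ε - A already
  -- dominates `RHC ε (1 / 2)`, B dominates `q ^ 3`, and only C must be absorbed.
  rcases le_or_gt (1 / 2) r with hr | hr
  · have hB0 : q ^ (1 / a) * (1 / 2) ^ (1 / b) ≤ B :=
      le_trans (by gcongr) (hB a b ha₀ ha₁ hb₀ hb₁ hab)
    have hRB : RHC ε (1 / 2) ≤ B := by
      rw [hR]
      exact le_trans (by gcongr) hB0
    have hCB : C ≤ 1 / 100 * B := by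
      calc C ≤ ε ^ (0.9 : ℝ) * q ^ (0.5 : ℝ) := hC
        -- The factor `ε ^ 0.001` pays for `(1 / 2) ^ (1 / b)`; the remaining exponent 1.399 still
        -- exceeds 1 / a ≤ 1.126 by a margin.
        _ = ε ^ (0.899 : ℝ) * q ^ (0.5 : ℝ) * ε ^ (0.001 : ℝ) := by
          rw [mul_right_comm, ← rpow_add hε_pos]
          norm_num
        _ ≤ q ^ (0.899 : ℝ) * q ^ (0.5 : ℝ) * (1 / 2) ^ (1 / b) := by gcongr
        _ = q ^ (1.399 : ℝ) * (1 / 2) ^ (1 / b) := by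
          rw [← rpow_add hq_pos]
          norm_num
        _ ≤ (1 / 100 * q ^ (1 / a)) * (1 / 2) ^ (1 / b) := by
          gcongr
          exact rpow_le_div_hundred_mul_rpow hq_pos hq_small (by linarith)
        _ ≤ 1 / 100 * B := by linarith
    exact max_le (by linarith [pow_nonneg hq₀ 3]) (by linarith [pow_nonneg hq₀ 3])
  have hAR : RHC ε (1 / 2) ≤ ε - A := by
    rw [hR]
    refine le_trans ?_ (hA' a b ha₀ ha₁ hb₀ hb₁ hab)
    gcongr
    linarith
  have hR₀ : 0 ≤ RHC ε (1 / 2) := by rw [hR]; positivity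
  have hq3 := pow_nonneg hq₀ 3
  -- C is absorbed by ε - A when q is below √ε.
  rcases le_or_gt q (ε ^ (0.5 : ℝ)) with hqε | hqε
  · have hCR : C ≤ 1 / 100 * RHC ε (1 / 2) := by
      calc C ≤ ε ^ (0.9 : ℝ) * q ^ (0.5 : ℝ) := hC
        _ ≤ ε ^ (0.9 : ℝ) * (ε ^ (0.5 : ℝ)) ^ (0.5 : ℝ) := by gcongr
        _ = ε ^ (1.15 : ℝ) := by
          rw [← rpow_mul hε₀, ← rpow_add hε_pos]
          norm_num
        _ ≤ 1 / 100 * ε ^ (1 / a + 0.001 : ℝ) :=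
          rpow_le_div_hundred_mul_rpow hε_pos hε_small (by linarith)
        _ ≤ 1 / 100 * RHC ε (1 / 2) := by
          rw [hR, rpow_add hε_pos]
          gcongr
    exact max_le (by linarith) (by linarith)
  -- For small r, both A and C are negligible against ε; for larger r, C is negligible against B ≥
  -- `(q * r) ^ 1.5`.
  rcases le_or_gt r (ε ^ (0.25 : ℝ)) with hrε | hrε
  · have hA1 : A ≤ 1 / 100 * ε := by
      calc A ≤ ε ^ (0.9 : ℝ) * r ^ (0.5 : ℝ) := hA
        _ ≤ ε ^ (0.9 : ℝ) * (ε ^ (0.25 : ℝ)) ^ (0.5 : ℝ) := by gcongr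
        _ = ε ^ (1.025 : ℝ) := by
          rw [← rpow_mul hε₀, ← rpow_add hε_pos]
          norm_num
        _ ≤ 1 / 100 * ε ^ (1 : ℝ) := rpow_le_div_hundred_mul_rpow hε_pos hε_small (by norm_num)
        _ = 1 / 100 * ε := by rw [rpow_one]
    have hC1 : C ≤ 2 / 100 * ε := by
      calc C ≤ ε ^ (0.9 : ℝ) * q ^ (0.5 : ℝ) := hC
        _ ≤ ε ^ (0.9 : ℝ) * ((2 * ε) ^ (1 / 3 : ℝ)) ^ (0.5 : ℝ) := by gcongr
        _ = 2 ^ (1 / 6 : ℝ) * ε ^ (0.9 + 1 / 6 : ℝ) := by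
          rw [← rpow_mul (by positivity), mul_rpow (by norm_num) hε₀, rpow_add hε_pos]
          norm_num
          ring
        _ ≤ 2 ^ (1 : ℝ) * (1 / 100 * ε ^ (1 : ℝ)) :=
          mul_le_mul (rpow_le_rpow_of_exponent_le (by norm_num) (by norm_num))
            (rpow_le_div_hundred_mul_rpow hε_pos hε_small (by norm_num)) (by positivity) (by positivity)
        _ = 2 / 100 * ε := by rw [rpow_one, rpow_one]; ring
    exact max_le (by linarith) (by linarith)
  · have hCB : C ≤ 1 / 100 * B := by
      calc C ≤ ε ^ (0.9 : ℝ) * q ^ (0.5 : ℝ) := hC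
        _ = ε ^ (0.525 : ℝ) * (q ^ (0.5 : ℝ) * ε ^ (0.375 : ℝ)) := by
          rw [mul_left_comm, ← rpow_add hε_pos, mul_comm]
          norm_num
        _ ≤ 1 / 100 * ε ^ (0.5 : ℝ) * (q ^ (0.5 : ℝ) * ε ^ (0.375 : ℝ)) := by
          gcongr
          exact rpow_le_div_hundred_mul_rpow hε_pos hε_small (by norm_num)
        _ ≤ 1 / 100 * q * (q ^ (0.5 : ℝ) * (ε ^ (0.25 : ℝ)) ^ (1.5 : ℝ)) := by
          rw [← rpow_mul hε₀ 0.25 1.5]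
          norm_num
          gcongr
          norm_num at hqε
          exact hqε.le
        _ ≤ 1 / 100 * q * (q ^ (0.5 : ℝ) * r ^ (1.5 : ℝ)) := by gcongr
        _ = 1 / 100 * (q ^ (1.5 : ℝ) * r ^ (1.5 : ℝ)) := by
          rw [show (1.5 : ℝ) = 1 + 0.5 by norm_num, rpow_add hq_pos, rpow_one]
          ring
        _ ≤ 1 / 100 * B := by linarith
    exact max_le (by linarith) (by linarith)

/-- The bounds are symmetric under exchanging g with h, so the smaller of q and r may play the role
of q. -/
theorem max_le_of_correlation_bounds {ε q r A B C : ℝ} (hε₀ : 0 ≤ ε)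
    (hε : ε ≤ (2 : ℝ) ^ (-500000 : ℝ)) (hεq : ε ≤ q) (hεr : ε ≤ r)
    (hAε : A ≤ ε) (hCε : C ≤ ε) (hA : A ≤ ε ^ (0.9 : ℝ) * r ^ (0.5 : ℝ))
    (hC : C ≤ ε ^ (0.9 : ℝ) * q ^ (0.5 : ℝ))
    (hB : ∀ a b : ℝ, 0 < a → a < 1 → 0 < b → b < 1 → (1 - a) * (1 - b) = 1 / 9 →
      q ^ (1 / a) * r ^ (1 / b) ≤ B)
    (hA' : ∀ a b : ℝ, 0 < a → a < 1 → 0 < b → b < 1 → (1 - a) * (1 - b) = 1 / 9 →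
      ε ^ (1 / a) * (1 - r) ^ (1 / b) ≤ ε - A)
    (hC' : ∀ a b : ℝ, 0 < a → a < 1 → 0 < b → b < 1 → (1 - a) * (1 - b) = 1 / 9 →
      ε ^ (1 / a) * (1 - q) ^ (1 / b) ≤ ε - C) :
    max (min q r ^ 3) (RHC ε (1 / 2)) ≤ 10 * (ε + B - A - C) := by
  rcases le_total q r with h | h
  · rw [min_eq_left h]
    exact max_le_of_correlation_bounds_of_le hε₀ hε hεq h hAε hCε hA hC hB hA'
  · rw [min_eq_right h, sub_right_comm]
    refine max_le_of_correlation_bounds_of_le hε₀ hε hεr h hCε hAε hC hA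
      (fun a b ha₀ ha₁ hb₀ hb₁ hab => ?_) hC'
    rw [mul_comm]
    exact hB b a hb₀ hb₁ ha₀ ha₁ (by rw [mul_comm, hab])

/-! ### Transitivity, distance and cyclic choices -/

theorem uniformProb_eq_piMean {n : ℕ} (p : Profile 3 n → Prop) [DecidablePred p] :
    uniformProb p = piMean fun X => if p X then (1 : ℝ) else 0 := by
  unfold uniformProb piMean
  rw [Finset.sum_boole, Fintype.card_pi_const]
  push_cast
  congr!

/-- The preference of an outcome between `i` and the cyclically next alternative. -/
def cycOutcome (o : Outcome 3) (i : Fin 3) : Bool := societyPrefers o i (i + 1)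

/-- The outcome with given preferences between each alternative and the cyclically next one. -/
def ofCycOutcome (u : Fin 3 → Bool) : Outcome 3 :=
  fun x => if x.1.2 = x.1.1 + 1 then u x.1.1 else !u x.1.2

theorem cycOutcome_ofCycOutcome : ∀ (u : Fin 3 → Bool) (i : Fin 3),
    cycOutcome (ofCycOutcome u) i = u i := by
  decide

theorem ofCycOutcome_cycOutcome : ∀ o : Outcome 3, ofCycOutcome (cycOutcome o) = o := by
  decide

theorem cycOutcome_injective : Function.Injective cycOutcome :=
  Function.LeftInverse.injective ofCycOutcome_cycOutcome

theorem not_isTransitive_iff : ∀ (i : Fin 3) (o : Outcome 3), ¬ o.IsTransitive ↔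
    cycOutcome o i = cycOutcome o (i + 1) ∧ cycOutcome o i = cycOutcome o (i + 2) := by
  unfold Outcome.IsTransitive
  decide

theorem isTransitive_of_ne : ∀ (o : Outcome 3) (i j : Fin 3),
    cycOutcome o i ≠ cycOutcome o j → o.IsTransitive := by
  unfold Outcome.IsTransitive
  decide

theorem societyPrefers_swap {k : ℕ} (o : Outcome k) {a b : Fin k} (h : a ≠ b) :
    societyPrefers o b a = !societyPrefers o a b := by
  unfold societyPrefers
  rcases lt_or_gt_of_ne h with h | h <;> simp [h, h.not_gt]

theorem voterPrefers_swap {k : ℕ} (σ : Ranking k) {a b : Fin k} (h : a ≠ b) :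
    voterPrefers σ b a = !voterPrefers σ a b := by
  unfold voterPrefers
  rcases lt_or_gt_of_ne (σ.injective.ne h) with h | h <;> simp [h, h.le]

theorem iia_ofCycOutcome {n : ℕ} (u : Profile 3 n → Fin 3 → Bool)
    (hu : ∀ i X Y, cycPref i X = cycPref i Y → u X i = u Y i) :
    IIA fun X => ofCycOutcome (u X) := by
  have hcyc : ∀ (i : Fin 3) (X Y : Profile 3 n),
      (∀ v, voterPrefers (X v) i (i + 1) = voterPrefers (Y v) i (i + 1)) →
      societyPrefers (ofCycOutcome (u X)) i (i + 1)
        = societyPrefers (ofCycOutcome (u Y)) i (i + 1) := by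
    intro i X Y h
    have := hu i X Y (funext h)
    rwa [← cycOutcome_ofCycOutcome (u X), ← cycOutcome_ofCycOutcome (u Y)] at this
  have hcases : ∀ a b : Fin 3, a = b ∨ b = a + 1 ∨ (b ≠ a ∧ a = b + 1) := by decide
  intro a b X Y h
  rcases hcases a b with rfl | rfl | ⟨hne, rfl⟩
  · simp [societyPrefers]
  · exact hcyc a X Y h
  · rw [societyPrefers_swap _ hne, societyPrefers_swap _ hne, hcyc b X Y fun v => ?_]
    have := h v
    rwa [voterPrefers_swap _ hne, voterPrefers_swap _ hne, Bool.not_inj_iff] at this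

section core

variable {n : ℕ} {F : GSWF 3 n}

/-- The choice function on the pair of `i` and the cyclically next alternative. -/
def cycChoice (F : GSWF 3 n) (i : Fin 3) : (Fin n → Bool) → Bool := choiceFn F i (i + 1)

theorem IIA.cycOutcome_eq (hF : IIA F) (i : Fin 3) (X : Profile 3 n) :
    cycOutcome (F X) i = cycChoice F i (cycPref i X) :=
  hF.societyPrefers_eq (by revert i; decide) X

/-- An IIA GSWF is close to a transitive one in which the choices on two of the cyclic pairs are
constant and opposite. -/
theorem IIA.D₁_le (hF : IIA F) {i k : Fin 3} (hik : k ≠ i) (s : Bool) :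
    D₁ F ≤ piMean (levelInd (cycChoice F i) s) + piMean (levelInd (cycChoice F k) (!s)) := by
  obtain ⟨u, hu⟩ : ∃ u : Profile 3 n → Fin 3 → Bool, ∀ X j, u X j =
      if j = i then !s else if j = k then s else cycOutcome (F X) j :=
    ⟨fun X j => _, fun X j => rfl⟩
  have hmem : (fun X => ofCycOutcome (u X)) ∈ transitiveFamily 3 n := by
    refine ⟨iia_ofCycOutcome u fun j X Y h => ?_, fun X => ?_⟩
    · rw [hu, hu, hF.cycOutcome_eq, hF.cycOutcome_eq, h]
    · refine isTransitive_of_ne _ i k ?_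
      rw [cycOutcome_ofCycOutcome, cycOutcome_ofCycOutcome, hu, hu, if_pos rfl, if_neg hik,
        if_pos rfl]
      exact Bool.not_ne_self s
  refine ((D₁_isLeast F).2 (Set.mem_image_of_mem _ hmem)).trans ?_
  classical
  rw [gswfDist, uniformProb_eq_piMean, ← piMean_comp_cycPref i (levelInd (cycChoice F i) s),
    ← piMean_comp_cycPref k (levelInd (cycChoice F k) (!s)), ← piMean_add]
  refine piMean_mono fun X => ?_
  unfold levelInd
  rw [← hF.cycOutcome_eq, ← hF.cycOutcome_eq]
  by_cases h₁ : cycOutcome (F X) i = s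
  · rw [if_pos h₁]
    split_ifs <;> norm_num
  by_cases h₂ : cycOutcome (F X) k = !s
  · rw [if_pos h₂]
    split_ifs <;> norm_num
  -- Outside both events the two choices of `F` already have their forced values, so the outcomes
  -- coincide.
  rw [if_neg (not_not.2 _)]
  · split_ifs
    norm_num
  · refine cycOutcome_injective (funext fun j => ?_)
    rw [cycOutcome_ofCycOutcome, hu]
    split_ifs with hi hk
    · subst hi
      exact (Bool.eq_not.2 h₁)
    · subst hk
      simpa using h₂
    · rfl

/-- Pointwise, f(1 - g)(1 - h) + (1 - f)gh = f + gh - fh - fg, so only correlations of pairs enter.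
Each product is written with cyclically consecutive indices, as the correlation bounds require. -/
theorem IIA.nonTransProb_eq (hF : IIA F) (i : Fin 3) (s : Bool) :
    nonTransProb F = piMean (levelInd (cycChoice F i) s)
      + (piMean fun X : Profile 3 n => levelInd (cycChoice F (i + 1)) (!s) (cycPref (i + 1) X)
          * levelInd (cycChoice F (i + 2)) (!s) (cycPref (i + 1 + 1) X))
      - (piMean fun X : Profile 3 n => levelInd (cycChoice F (i + 2)) (!s) (cycPref (i + 2) X)
          * levelInd (cycChoice F i) s (cycPref (i + 2 + 1) X))
      - (piMean fun X : Profile 3 n => levelInd (cycChoice F i) s (cycPref i X)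
          * levelInd (cycChoice F (i + 1)) (!s) (cycPref (i + 1) X)) := by
  classical
  have h₁ : i + 1 + 1 = i + 2 := by rw [add_assoc]; rfl
  have h₂ : i + 2 + 1 = i := by rw [add_assoc]; exact add_zero i
  rw [nonTransProb, uniformProb_eq_piMean, h₁, h₂,
    ← piMean_comp_cycPref i (levelInd (cycChoice F i) s), ← piMean_add, ← piMean_sub, ← piMean_sub]
  congr 1
  funext X
  simp only [not_isTransitive_iff i, levelInd, ← hF.cycOutcome_eq]
  generalize cycOutcome (F X) i = x
  generalize cycOutcome (F X) (i + 1) = y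
  generalize cycOutcome (F X) (i + 2) = z
  cases x <;> cases y <;> cases z <;> cases s <;> simp

theorem D₂'_le (F : GSWF 3 n) (i : Fin 3) (s : Bool) :
    D₂' F ≤ piMean (levelInd (cycChoice F i) s) := by
  have hpbar : ∀ i, pbar (expect (cycChoice F i)) ≤ piMean (levelInd (cycChoice F i) s) := by
    intro i
    rw [pbar, expect_eq_piMean, ← piMean_levelInd_not]
    cases s
    · exact min_le_right _ _
    · exact min_le_left _ _
  refine le_trans ?_ (hpbar i)
  unfold D₂'
  match i with
  | 0 => exact min_le_left _ _
  | 1 => exact (min_le_right _ _).trans (min_le_left _ _)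
  | 2 => exact (min_le_right _ _).trans (min_le_right _ _)

theorem exists_D₂'_eq (F : GSWF 3 n) :
    ∃ i s, D₂' F = piMean (levelInd (cycChoice F i) s) := by
  have hpbar : ∀ i, ∃ s, pbar (expect (cycChoice F i)) = piMean (levelInd (cycChoice F i) s) := by
    intro i
    rw [pbar, expect_eq_piMean, ← piMean_levelInd_not]
    rcases min_choice (piMean (levelInd (cycChoice F i) true))
      (piMean (levelInd (cycChoice F i) (!true))) with h | h
    · exact ⟨true, h⟩
    · exact ⟨false, h⟩
  have hmin : ∃ i, D₂' F = pbar (expect (cycChoice F i)) := by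
    unfold D₂'
    rcases min_choice (pbar (expect (choiceFn F 0 1)))
      (min (pbar (expect (choiceFn F 1 2))) (pbar (expect (choiceFn F 2 0)))) with h | h
    · exact ⟨0, h⟩
    · rw [h]
      rcases min_choice (pbar (expect (choiceFn F 1 2))) (pbar (expect (choiceFn F 2 0))) with h | h
      · exact ⟨1, h⟩
      · exact ⟨2, h⟩
  obtain ⟨i, hi⟩ := hmin
  obtain ⟨s, hs⟩ := hpbar i
  exact ⟨i, s, hi.trans hs⟩

theorem D₁_nonneg (F : GSWF 3 n) : 0 ≤ D₁ F := by
  obtain ⟨G, -, hG⟩ := (D₁_isLeast F).1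
  rw [← hG]
  unfold gswfDist uniformProb
  positivity

theorem piMean_levelInd_mul_le_left (i : Fin 3) (f g : (Fin n → Bool) → Bool) (s t : Bool) :
    (piMean fun X : Profile 3 n => levelInd f s (cycPref i X) * levelInd g t (cycPref (i + 1) X)) ≤
      piMean (levelInd f s) := by
  rw [← piMean_comp_cycPref i (levelInd f s)]
  exact piMean_mono fun X => mul_le_of_le_one_right (levelInd_nonneg _ _ _) (levelInd_le_one _ _ _)

theorem piMean_levelInd_mul_le_right (i : Fin 3) (f g : (Fin n → Bool) → Bool) (s t : Bool) :
    (piMean fun X : Profile 3 n => levelInd f s (cycPref i X) * levelInd g t (cycPref (i + 1) X)) ≤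
      piMean (levelInd g t) := by
  rw [← piMean_comp_cycPref (i + 1) (levelInd g t)]
  exact piMean_mono fun X => mul_le_of_le_one_left (levelInd_nonneg _ _ _) (levelInd_le_one _ _ _)

theorem piMean_levelInd_mul_not_right (i : Fin 3) (f g : (Fin n → Bool) → Bool) (s t : Bool) :
    (piMean fun X : Profile 3 n =>
        levelInd f s (cycPref i X) * levelInd g (!t) (cycPref (i + 1) X)) =
      piMean (levelInd f s) - piMean fun X : Profile 3 n =>
        levelInd f s (cycPref i X) * levelInd g t (cycPref (i + 1) X) := by
  rw [← piMean_comp_cycPref i (levelInd f s), ← piMean_sub]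
  simp only [levelInd_not, mul_sub, mul_one]

theorem piMean_levelInd_mul_not_left (i : Fin 3) (f g : (Fin n → Bool) → Bool) (s t : Bool) :
    (piMean fun X : Profile 3 n =>
        levelInd f (!s) (cycPref i X) * levelInd g t (cycPref (i + 1) X)) =
      piMean (levelInd g t) - piMean fun X : Profile 3 n =>
        levelInd f s (cycPref i X) * levelInd g t (cycPref (i + 1) X) := by
  rw [← piMean_comp_cycPref (i + 1) (levelInd g t), ← piMean_sub]
  simp only [levelInd_not, sub_mul, one_mul]

end core

end Arrow

/-! ### Conclusion -/

theorem lemma3p1 (n : ℕ) (F : Arrow.GSWF 3 n) (hF : Arrow.IIA F)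
    (hD : Arrow.D₂' F ≤ (2 : ℝ) ^ (-500000 : ℝ)) :
    (1 / 10 : ℝ) * max (Arrow.RHC (Arrow.D₁ F / 2) (Arrow.D₁ F / 2))
        (Arrow.RHC (Arrow.D₂' F) (1 / 2)) ≤
      Arrow.nonTransProb F := by
  open Arrow in
  obtain ⟨i, s, hi⟩ := exists_D₂'_eq F
  have hq := D₂'_le F (i + 1) (!s)
  have hr := D₂'_le F (i + 2) (!s)
  -- The distance is at most ε + q and at most ε + r, and ε is the least of the three.
  have hD₁ : D₁ F / 2 ≤ min (piMean (levelInd (cycChoice F (i + 1)) (!s)))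
      (piMean (levelInd (cycChoice F (i + 2)) (!s))) := by
    have h₁ := hF.D₁_le (k := i + 1) (i := i) (by revert i; simp) s
    have h₂ := hF.D₁_le (k := i + 2) (i := i) (by revert i; simp) s
    rw [← hi] at h₁ h₂
    exact le_min (by linarith) (by linarith)
  rw [hi] at hD hq hr ⊢
  have hcycle : i + 2 + 1 = i := by rw [add_assoc]; exact add_zero i
  have key := max_le_of_correlation_bounds (piMean_levelInd_nonneg _ _) hD hq hr
    (piMean_levelInd_mul_le_right (i + 2) (cycChoice F (i + 2)) (cycChoice F i) (!s) s)
    (piMean_levelInd_mul_le_left i (cycChoice F i) (cycChoice F (i + 1)) s (!s))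
    (piMean_le_rpow_mul_rpow_swap (i + 2) _ _ _ _) (piMean_le_rpow_mul_rpow i _ _ _ _)
    (fun a b ha₀ ha₁ hb₀ hb₁ hab => rpow_mul_rpow_le_piMean ha₀ ha₁ hb₀ hb₁ hab (i + 1)
      (cycChoice F (i + 1)) (cycChoice F (i + 2)) (!s) (!s))
    -- P(f) - P(f ∧ h) is the probability of f ∧ ¬h, again a correlation of adjacent choices; here f
    -- is the second factor, so the exponents trade places.
    (fun a b ha₀ ha₁ hb₀ hb₁ hab => by
      rw [← piMean_levelInd_not, ← piMean_levelInd_mul_not_left, mul_comm]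
      exact rpow_mul_rpow_le_piMean hb₀ hb₁ ha₀ ha₁ (by rw [mul_comm, hab]) (i + 2) _ _ _ _)
    (fun a b ha₀ ha₁ hb₀ hb₁ hab => by
      rw [← piMean_levelInd_not, ← piMean_levelInd_mul_not_right]
      exact rpow_mul_rpow_le_piMean ha₀ ha₁ hb₀ hb₁ hab i _ _ _ _)
  have hD₁' : 0 ≤ D₁ F / 2 := by have := D₁_nonneg F; positivity
  rw [RHC_self hD₁', hF.nonTransProb_eq i s]
  have hcube := (max_le_max (pow_le_pow_left₀ hD₁' hD₁ 3) le_rfl).trans key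
  linarith
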